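/- For integers $F, K \ge 1$ and $0 \le Z \le F$ and a finite set $S$, an $S$-PDA$(F,K,Z)$ (placement delivery array) is an $F \times K$ array $R = (r_{j,k})$ such that: (1) each cell is either empty or an element of $S$; (2) each column contains exactly $Z$ empty cells; (3) each row and each column contains every element of $S$ at most once; (4) if two different cells satisfy $r_{j_1,k_1} = r_{j_2,k_2} = t \in S$, then the cells $r_{j_1,k_2}$ and $r_{j_2,k_1}$ are empty. Let $s(F,K,Z) = \min\{\,|S| : \text{there is an } S\text{-PDA}(F,K,Z)\,\}$. Theorem. For every integer $F \ge 12$, $s(F,4,3) = 4F - 30$. -/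

import Mathlib

/-- An `F × K` array `R` with entries in `S` (`none` is the empty cell) is an
`S`-PDA`(F, K, Z)`, a placement delivery array. That each cell is either empty or an element
of `S` is expressed by the type of `R`. -/
structure IsPDA {S : Type*} (F K Z : ℕ) (R : Fin F → Fin K → Option S) : Prop where
  /-- Each column contains exactly `Z` empty cells. -/
  empty_cells : ∀ k, (Finset.univ.filter fun j => R j k = none).card = Z
  /-- Each row contains an element of `S` at most once. -/
  row_once : ∀ (t : S) (j : Fin F) (k₁ k₂ : Fin K),
    R j k₁ = some t → R j k₂ = some t → k₁ = k₂
  /-- Each column contains an element of `S` at most once. -/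
  col_once : ∀ (t : S) (j₁ j₂ : Fin F) (k : Fin K),
    R j₁ k = some t → R j₂ k = some t → j₁ = j₂
  /-- If two different cells contain the same element, the two opposite corners are empty. -/
  corners_empty : ∀ (t : S) (j₁ j₂ : Fin F) (k₁ k₂ : Fin K), (j₁, k₁) ≠ (j₂, k₂) →
    R j₁ k₁ = some t → R j₂ k₂ = some t → R j₁ k₂ = none ∧ R j₂ k₁ = none

/-- The set of all `|S|` for which there is an `S`-PDA`(F, K, Z)`; up to relabelling, `S` is
`Fin n`. -/
def pdaSizes (F K Z : ℕ) : Set ℕ :=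
  {n | ∃ R : Fin F → Fin K → Option (Fin n), IsPDA F K Z R}

/-- `s(F, K, Z)`, the minimum of `|S|` over all `S`-PDA`(F, K, Z)`. (For `Z ≤ F` such arrays
exist, so that the infimum is a minimum.) -/
noncomputable def pdaMin (F K Z : ℕ) : ℕ := sInf (pdaSizes F K Z)

/-!
Give every nonempty cell the weight `1 / (e + 1)`, where `e` is the number of empty cells of its
row. If `t` occurs `m` times, then an occurrence of `t` sees an empty corner in its row for each
of the other `m - 1`, so that the weights of the occurrences of `t` add up to at most `1`. Hence
`|S|` is at least the sum of `(K - e) / (e + 1)` over the rows. This is convex in `e`, so it is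
at least the linear function of `e` with the same values at `0` and `1`, and summing that
function only requires the total number `K * Z` of empty cells.

Equality holds if each row has at most one empty cell and an element occurs twice or once
according to whether its rows have an empty cell or not. The `K × K` array with empty diagonal
and the unordered pair `{a, k}` in cell `(a, k)` is of this kind; `Z` disjoint copies of it,
stacked together with rows of new elements, are optimal.
-/

section LowerBound

open Finset

variable {S : Type*} {F K Z : ℕ}

/-- The number of empty cells in row `j` of the array `R`. -/
def rowEmptyCount (R : Fin F → Fin K → Option S) (j : Fin F) : ℕ :=
  #{k | R j k = none}

/-- The set of cells, as pairs (row, column), that contain the element `t` in the array `R`. -/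
def occurrences [DecidableEq S] (R : Fin F → Fin K → Option S) (t : S) : Finset (Fin F × Fin K) :=
  {c | R c.1 c.2 = some t}

theorem mem_occurrences [DecidableEq S] {R : Fin F → Fin K → Option S} {t : S}
    {c : Fin F × Fin K} : c ∈ occurrences R t ↔ R c.1 c.2 = some t := by
  simp [occurrences]

theorem IsPDA.sum_rowEmptyCount {R : Fin F → Fin K → Option S} (h : IsPDA F K Z R) :
    ∑ j, rowEmptyCount R j = K * Z := by
  simp only [rowEmptyCount, card_filter]
  rw [sum_comm]
  simp [h.empty_cells]

theorem IsPDA.card_occurrences_le [DecidableEq S] {R : Fin F → Fin K → Option S}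
    (h : IsPDA F K Z R) {t : S} {c : Fin F × Fin K} (hc : c ∈ occurrences R t) :
    #(occurrences R t) ≤ rowEmptyCount R c.1 + 1 := by
  rw [← card_erase_add_one hc]
  -- Every other occurrence `d` of `t` empties the corner of row `c.1` in the column of `d`.
  refine Nat.add_le_add_right (card_le_card_of_injOn Prod.snd ?corner_empty ?inj) 1
  case corner_empty =>
    intro d hd
    obtain ⟨hdc, hd⟩ := mem_erase.1 hd
    have corner : R c.1 d.2 = none :=
      (h.corners_empty t c.1 d.1 c.2 d.2 (Ne.symm hdc)
        (mem_occurrences.1 hc) (mem_occurrences.1 hd)).1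
    simpa using corner
  case inj =>
    intro d hd d' hd' hcol
    have hd := mem_occurrences.1 (mem_of_mem_erase hd)
    have hd' := mem_occurrences.1 (mem_of_mem_erase hd')
    exact Prod.ext (h.col_once t d.1 d'.1 d.2 hd (hcol ▸ hd')) hcol

theorem IsPDA.sum_occurrences_inv_le_one [DecidableEq S] {R : Fin F → Fin K → Option S}
    (h : IsPDA F K Z R) (t : S) :
    ∑ c ∈ occurrences R t, ((rowEmptyCount R c.1 : ℚ) + 1)⁻¹ ≤ 1 := by
  calc ∑ c ∈ occurrences R t, ((rowEmptyCount R c.1 : ℚ) + 1)⁻¹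
      ≤ ∑ _c ∈ occurrences R t, (#(occurrences R t) : ℚ)⁻¹ := by
        refine sum_le_sum fun c hc => ?_
        have hpos : (0 : ℚ) < #(occurrences R t) := by exact_mod_cast card_pos.2 ⟨c, hc⟩
        exact inv_anti₀ hpos (by exact_mod_cast h.card_occurrences_le hc)
    _ = #(occurrences R t) * (#(occurrences R t) : ℚ)⁻¹ := by rw [sum_const, nsmul_eq_mul]
    _ ≤ 1 := mul_inv_le_one

theorem card_nonempty_row_eq_sub {M : Type*} [AddGroupWithOne M]
    (R : Fin F → Fin K → Option S) (j : Fin F) :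
    (#{k | R j k ≠ none} : M) = K - rowEmptyCount R j := by
  have hsplit : #{k | R j k ≠ none} + rowEmptyCount R j = K := by
    simpa [rowEmptyCount] using card_filter_add_card_filter_not (s := (univ : Finset (Fin K)))
      (fun k => R j k ≠ none)
  exact eq_sub_of_add_eq (by rw [← Nat.cast_add, hsplit])

theorem sum_sum_occurrences [Fintype S] [DecidableEq S] {M : Type*} [Ring M]
    (R : Fin F → Fin K → Option S) (w : Fin F → M) :
    ∑ t, ∑ c ∈ occurrences R t, w c.1 = ∑ j, (K - rowEmptyCount R j) * w j := by
  have sum_elements (j : Fin F) (k : Fin K) :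
      ∑ t, (if R j k = some t then w j else 0) = if R j k ≠ none then w j else 0 := by
    cases R j k <;> simp
  simp only [occurrences, sum_filter]
  rw [sum_comm, Fintype.sum_prod_type]
  refine sum_congr rfl fun j _ => ?_
  simp only [sum_elements]
  rw [← sum_filter, sum_const, nsmul_eq_mul, card_nonempty_row_eq_sub]

theorem IsPDA.sum_div_le_card [Fintype S] {R : Fin F → Fin K → Option S} (h : IsPDA F K Z R) :
    ∑ j, ((K : ℚ) - rowEmptyCount R j) / (rowEmptyCount R j + 1) ≤ Fintype.card S := by
  classical
  simp only [div_eq_mul_inv]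
  rw [← sum_sum_occurrences R fun j => ((rowEmptyCount R j : ℚ) + 1)⁻¹]
  calc ∑ t, ∑ c ∈ occurrences R t, ((rowEmptyCount R c.1 : ℚ) + 1)⁻¹
      ≤ ∑ _t : S, (1 : ℚ) := sum_le_sum fun t _ => h.sum_occurrences_inv_le_one t
    _ = Fintype.card S := by simp

/-- The right-hand side is convex in `e`, and the left-hand side is its chord through `e = 0`
and `e = 1`. -/
theorem sub_mul_half_le_sub_div (K e : ℕ) :
    (K : ℚ) - e * ((K + 1) / 2) ≤ (K - e) / (e + 1) := by
  have hgap : ((K : ℚ) - e) / (e + 1) - (K - e * ((K + 1) / 2)) =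
      (K + 1) * (e * (e - 1)) / (2 * (e + 1)) := by
    field_simp
    ring
  have hchord : (0 : ℚ) ≤ e * (e - 1) := by
    rcases e.eq_zero_or_pos with rfl | he
    · simp
    · have : (1 : ℚ) ≤ e := by exact_mod_cast he
      exact mul_nonneg (by positivity) (by linarith)
  have : (0 : ℚ) ≤ (K + 1) * (e * (e - 1)) / (2 * (e + 1)) := by positivity
  linarith

theorem IsPDA.mul_le_card_add [Fintype S] {R : Fin F → Fin K → Option S} (h : IsPDA F K Z R) :
    K * F ≤ Fintype.card S + Z * (K + 1).choose 2 := by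
  have hempty : ∑ j, (rowEmptyCount R j : ℚ) = K * Z := by exact_mod_cast h.sum_rowEmptyCount
  have hbound : (K : ℚ) * F - K * Z * ((K + 1) / 2) ≤ Fintype.card S :=
    calc (K : ℚ) * F - K * Z * ((K + 1) / 2)
        = ∑ j, ((K : ℚ) - rowEmptyCount R j * ((K + 1) / 2)) := by
          rw [sum_sub_distrib, ← sum_mul, hempty]
          simp [mul_comm]
      _ ≤ ∑ j, ((K : ℚ) - rowEmptyCount R j) / (rowEmptyCount R j + 1) :=
          sum_le_sum fun j _ => sub_mul_half_le_sub_div K (rowEmptyCount R j)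
      _ ≤ Fintype.card S := h.sum_div_le_card
  have hchoose : ((K + 1).choose 2 : ℚ) = K * ((K + 1) / 2) := by
    rw [Nat.cast_choose_two]
    push_cast
    ring
  have : (K : ℚ) * F ≤ Fintype.card S + Z * (K + 1).choose 2 := by
    rw [hchoose]
    linarith
  exact_mod_cast this

end LowerBound

section Construction

variable {S T : Type*} {F F₁ F₂ K Z Z₁ Z₂ n n₁ n₂ : ℕ}

theorem IsPDA.map_injective {R : Fin F → Fin K → Option S} (h : IsPDA F K Z R) {f : S → T}
    (hf : Function.Injective f) : IsPDA F K Z fun j k => (R j k).map f where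
  empty_cells k := by simpa using h.empty_cells k
  row_once t j k₁ k₂ h₁ h₂ := by
    obtain ⟨s, hs, rfl⟩ := Option.map_eq_some_iff.1 h₁
    exact h.row_once s j k₁ k₂ hs (Option.map_injective hf h₂)
  col_once t j₁ j₂ k h₁ h₂ := by
    obtain ⟨s, hs, rfl⟩ := Option.map_eq_some_iff.1 h₁
    exact h.col_once s j₁ j₂ k hs (Option.map_injective hf h₂)
  corners_empty t j₁ j₂ k₁ k₂ hne h₁ h₂ := by
    obtain ⟨s, hs, rfl⟩ := Option.map_eq_some_iff.1 h₁
    simpa using h.corners_empty s j₁ j₂ k₁ k₂ hne hs (Option.map_injective hf h₂)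

theorem IsPDA.card_mem_pdaSizes [Fintype S] {R : Fin F → Fin K → Option S} (h : IsPDA F K Z R) :
    Fintype.card S ∈ pdaSizes F K Z :=
  ⟨_, h.map_injective (Fintype.equivFin S).injective⟩

/-- The array `R₁` on top of the array `R₂`, whose elements are made disjoint from those
of `R₁`. -/
def stackArrays (R₁ : Fin F₁ → Fin K → Option S) (R₂ : Fin F₂ → Fin K → Option T) :
    Fin (F₁ + F₂) → Fin K → Option (S ⊕ T) :=
  Fin.addCases (fun j k => (R₁ j k).map Sum.inl) (fun j k => (R₂ j k).map Sum.inr)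

@[simp]
theorem stackArrays_castAdd (R₁ : Fin F₁ → Fin K → Option S) (R₂ : Fin F₂ → Fin K → Option T)
    (j : Fin F₁) (k : Fin K) :
    stackArrays R₁ R₂ (Fin.castAdd F₂ j) k = (R₁ j k).map Sum.inl := by
  simp [stackArrays]

@[simp]
theorem stackArrays_natAdd (R₁ : Fin F₁ → Fin K → Option S) (R₂ : Fin F₂ → Fin K → Option T)
    (j : Fin F₂) (k : Fin K) :
    stackArrays R₁ R₂ (Fin.natAdd F₁ j) k = (R₂ j k).map Sum.inr := by
  simp [stackArrays]

theorem IsPDA.stack {R₁ : Fin F₁ → Fin K → Option S} {R₂ : Fin F₂ → Fin K → Option T}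
    (h₁ : IsPDA F₁ K Z₁ R₁) (h₂ : IsPDA F₂ K Z₂ R₂) :
    IsPDA (F₁ + F₂) K (Z₁ + Z₂) (stackArrays R₁ R₂) where
  empty_cells k := by
    rw [← h₁.empty_cells k, ← h₂.empty_cells k]
    simp only [Finset.card_filter, Fin.sum_univ_add]
    simp
  row_once := by
    rintro (t | t) j k₁ k₂ <;> cases j using Fin.addCases
    case inl.left j => simpa using h₁.row_once t j k₁ k₂
    case inr.right j => simpa using h₂.row_once t j k₁ k₂
    all_goals simp
  col_once := by
    rintro (t | t) j₁ j₂ k <;> cases j₁ using Fin.addCases <;> cases j₂ using Fin.addCases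
    case inl.left.left j₁ j₂ => simpa using h₁.col_once t j₁ j₂ k
    case inr.right.right j₁ j₂ => simpa using h₂.col_once t j₁ j₂ k
    all_goals simp
  corners_empty := by
    rintro (t | t) j₁ j₂ k₁ k₂ <;> cases j₁ using Fin.addCases <;> cases j₂ using Fin.addCases
    case inl.left.left j₁ j₂ => simpa using h₁.corners_empty t j₁ j₂ k₁ k₂
    case inr.right.right j₁ j₂ => simpa using h₂.corners_empty t j₁ j₂ k₁ k₂
    all_goals simp

theorem add_mem_pdaSizes (h₁ : n₁ ∈ pdaSizes F₁ K Z₁) (h₂ : n₂ ∈ pdaSizes F₂ K Z₂) :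
    n₁ + n₂ ∈ pdaSizes (F₁ + F₂) K (Z₁ + Z₂) := by
  obtain ⟨R₁, h₁⟩ := h₁
  obtain ⟨R₂, h₂⟩ := h₂
  simpa using (h₁.stack h₂).card_mem_pdaSizes

theorem zero_mem_pdaSizes_zero (K : ℕ) : 0 ∈ pdaSizes 0 K 0 :=
  ⟨Fin.elim0, by constructor <;> simp⟩

theorem mul_mem_pdaSizes (h : n ∈ pdaSizes F K Z) (m : ℕ) :
    m * n ∈ pdaSizes (m * F) K (m * Z) := by
  induction m with
  | zero => simpa using zero_mem_pdaSizes_zero K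
  | succ m ih => simpa only [Nat.succ_mul] using add_mem_pdaSizes ih h

theorem self_mem_pdaSizes_one (K : ℕ) : K ∈ pdaSizes 1 K 0 :=
  ⟨fun _ k => some k, by simp,
    fun _ _ _ _ h₁ h₂ => Option.some.inj (h₁.trans h₂.symm),
    fun _ _ _ _ _ _ => Subsingleton.elim _ _,
    fun _ _ _ _ _ hne h₁ h₂ =>
      absurd (Prod.ext (Subsingleton.elim _ _) (Option.some.inj (h₁.trans h₂.symm))) hne⟩

/-- The square array with empty diagonal whose cell `(a, k)`, for `a ≠ k`, contains the unordered
pair of `a` and `k`. -/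
def pairArray (K : ℕ) (a k : Fin K) : Option {p : Sym2 (Fin K) // ¬p.IsDiag} :=
  if h : a = k then none else some ⟨s(a, k), h⟩

theorem pairArray_eq_none_iff {K : ℕ} {a k : Fin K} : pairArray K a k = none ↔ a = k := by
  simp [pairArray]

theorem pairArray_eq_some_iff {K : ℕ} {a k : Fin K} {p : {p : Sym2 (Fin K) // ¬p.IsDiag}} :
    pairArray K a k = some p ↔ s(a, k) = p := by
  obtain ⟨p, hp⟩ := p
  by_cases h : a = k
  · have : s(a, k) ≠ p := fun hap => hp (hap ▸ h)
    simpa [pairArray, h] using this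
  · simp [pairArray, h, Subtype.ext_iff]

theorem isPDA_pairArray (K : ℕ) : IsPDA K K 1 (pairArray K) where
  empty_cells k := by simp [pairArray_eq_none_iff, Finset.filter_eq']
  row_once p a k₁ k₂ h₁ h₂ := by
    rw [pairArray_eq_some_iff] at h₁ h₂
    exact Sym2.congr_right.1 (h₁.trans h₂.symm)
  col_once p a₁ a₂ k h₁ h₂ := by
    rw [pairArray_eq_some_iff] at h₁ h₂
    exact Sym2.congr_left.1 (h₁.trans h₂.symm)
  corners_empty p a₁ a₂ k₁ k₂ hne h₁ h₂ := by
    rw [pairArray_eq_some_iff] at h₁ h₂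
    simp only [pairArray_eq_none_iff]
    rcases Sym2.eq_iff.1 (h₁.trans h₂.symm) with ⟨ha, hk⟩ | ⟨ha, hk⟩
    · exact absurd (Prod.ext ha hk) hne
    · exact ⟨ha, hk.symm⟩

theorem choose_two_mem_pdaSizes (K : ℕ) : K.choose 2 ∈ pdaSizes K K 1 := by
  have hmem := (isPDA_pairArray K).card_mem_pdaSizes
  rwa [Sym2.card_subtype_not_diag, Fintype.card_fin] at hmem

theorem mul_choose_two_add_mul_mem_pdaSizes (K Z m : ℕ) :
    Z * K.choose 2 + m * K ∈ pdaSizes (Z * K + m) K Z := by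
  simpa using add_mem_pdaSizes (mul_mem_pdaSizes (choose_two_mem_pdaSizes K) Z)
    (mul_mem_pdaSizes (self_mem_pdaSizes_one K) m)

end Construction

theorem choose_two_add_succ_choose_two (K : ℕ) : K.choose 2 + (K + 1).choose 2 = K * K := by
  qify
  rw [Nat.cast_choose_two, Nat.cast_choose_two]
  push_cast
  ring

theorem mainTheorem10_general {F K Z : ℕ} (hF : Z * K ≤ F) :
    (pdaSizes F K Z).Nonempty ∧
      (pdaMin F K Z : ℤ) = K * F - Z * (K + 1).choose 2 := by
  obtain ⟨m, rfl⟩ := Nat.exists_eq_add_of_le hF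
  have hmem := mul_choose_two_add_mul_mem_pdaSizes K Z m
  refine ⟨⟨_, hmem⟩, ?_⟩
  have hle : pdaMin (Z * K + m) K Z ≤ Z * K.choose 2 + m * K := Nat.sInf_le hmem
  obtain ⟨R, hR⟩ : pdaMin (Z * K + m) K Z ∈ pdaSizes (Z * K + m) K Z := Nat.sInf_mem ⟨_, hmem⟩
  have hge := hR.mul_le_card_add
  rw [Fintype.card_fin] at hge
  have htotal : K * (Z * K + m) = Z * K.choose 2 + m * K + Z * (K + 1).choose 2 :=
    calc K * (Z * K + m) = Z * (K * K) + m * K := by ring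
      _ = Z * K.choose 2 + m * K + Z * (K + 1).choose 2 := by
        rw [← choose_two_add_succ_choose_two]
        ring
  zify at hle hge htotal
  push_cast
  linarith

theorem mainTheorem10 (F : ℕ) (hF : 12 ≤ F) :
    (pdaSizes F 4 3).Nonempty ∧ (pdaMin F 4 3 : ℤ) = 4 * (F : ℤ) - 30 := by
  simpa [Nat.choose] using mainTheorem10_general (K := 4) (Z := 3) hF
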